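/- Let $L$ be a set of integers, each at least $3$, that contains an even integer and has a largest element. Let $2\ell$ be the smallest even element of $L$ and let $k$ be the largest element of $L$. An $L$-cycle graph is a finite simple undirected graph in which the length (number of edges) of every cycle belongs to $L$, and $c(L,n)$ denotes the maximum number of cycles in an $n$-vertex $L$-cycle graph, where cycles are counted as subgraphs. Then $$c(L,n)=\Theta_L\left(n^{\lfloor k/\ell\rfloor}\right)\qquad (n\to\infty),$$ that is, there are constants $C_1,C_2>0$ and $n_0$, depending only on $L$, such that $C_1 n^{\lfloor k/\ell\rfloor}\le c(L,n)\le C_2 n^{\lfloor k/\ell\rfloor}$ for all $n\ge n_0$. -/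

import Mathlib

/-- The cycles of a graph `G`, as subgraphs of `G` (so that a cycle has neither a starting vertex
nor a direction). -/
def SimpleGraph.cycleSubgraphs {V : Type*} (G : SimpleGraph V) : Set G.Subgraph :=
  {H | ∃ (v : V) (p : G.Walk v v), p.IsCycle ∧ p.toSubgraph = H}

/-- `G` is an `L`-cycle graph: the length of every cycle of `G` belongs to `L`. -/
def SimpleGraph.IsLCycleGraph {V : Type*} (G : SimpleGraph V) (L : Set ℕ) : Prop :=
  ∀ (v : V) (p : G.Walk v v), p.IsCycle → p.length ∈ L

/-- The numbers of cycles of the `L`-cycle graphs on `n` vertices. -/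
def lCycleCounts (L : Set ℕ) (n : ℕ) : Set ℕ :=
  {N | ∃ G : SimpleGraph (Fin n), G.IsLCycleGraph L ∧ N = G.cycleSubgraphs.ncard}

/-- `c(L, n)`: the maximum number of cycles in an `L`-cycle graph on `n` vertices. -/
noncomputable def maxLCycles (L : Set ℕ) (n : ℕ) : ℕ :=
  sSup (lCycleCounts L n)

/-- The supremum in the definition of `c(L, n)` is a maximum. -/
theorem isGreatest_maxLCycles (L : Set ℕ) (n : ℕ) :
    IsGreatest (lCycleCounts L n) (maxLCycles L n) := by
  have hfin : (lCycleCounts L n).Finite := by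
    refine (Set.finite_range
      (fun G : SimpleGraph (Fin n) => G.cycleSubgraphs.ncard)).subset ?_
    rintro N ⟨G, -, rfl⟩
    exact ⟨G, rfl⟩
  have hne : (lCycleCounts L n).Nonempty :=
    ⟨_, ⊥, fun v p hp => by
      cases p with
      | nil => simp at hp
      | cons h _ => simp at h, rfl⟩
  exact ⟨Nat.sSup_mem hne hfin.bddAbove, fun _ h => le_csSup hfin.bddAbove h⟩

/-! Upper bound. Call an arc of a cycle flexible if its ends are joined by paths of the same length
whose interiors avoid any prescribed small vertex set (`Flexible`). Two such paths of length `g ≥ 2`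
form an even cycle, so `g ≥ l`; two flexible arcs that overlap at both ends of the cycle can be
rerouted into a longer cycle, which the bound `k` restricts. Hence some `k / l` edges spaced `l`
apart meet the interiors of all flexible arcs (`exists_piercing`). Bounded cycle length makes the
graph sparse, so these edges can be chosen in `O(n ^ (k / l))` ways. Once they are fixed, every gap
is a non-flexible arc, so a bounded set meets its interior; filling in the gaps costs only a
constant factor (`card_piercedSeqs_extending`).

Lower bound. In a `k`-cycle, replace each of `k / l` consecutive arcs of length `l` by about `n / k`
parallel copies (`bundledCycle`). A cycle either uses two copies of one arc, with length `2 * l`, or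
goes all the way round, with length `k`; independent choices of copies give `(n / k) ^ (k / l)`
cycles of the second kind. -/

/-- `c` runs once around a cycle of length `m` in `G` (if `3 ≤ m`). -/
def SimpleGraph.IsCyclicSeq {V : Type*} (G : SimpleGraph V) (m : ℕ) (c : ZMod m → V) : Prop :=
  Function.Injective c ∧ ∀ i, G.Adj (c i) (c (i + 1))

/-! ### Cycles as cyclic sequences, and their arcs -/

namespace SimpleGraph

variable {V : Type*} {G : SimpleGraph V}

theorem Walk.IsCycle.exists_isCyclicSeq {v : V} {p : G.Walk v v} (hp : p.IsCycle) :
    ∃ c : ZMod p.length → V, G.IsCyclicSeq p.length c ∧ ∀ i ≤ p.length, c (i : ℕ) = p.getVert i := by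
  have h3 := hp.three_le_length
  have : NeZero p.length := ⟨by omega⟩
  have key : ∀ i ≤ p.length, p.getVert ((i : ℕ) : ZMod p.length).val = p.getVert i := by
    intro i hi
    rcases hi.lt_or_eq with h | h
    · rw [ZMod.val_natCast, Nat.mod_eq_of_lt h]
    · subst h; simp
  refine ⟨fun i => p.getVert i.val, ⟨?_, ?_⟩, key⟩
  · intro i j hij
    have hi := i.val_lt
    have hj := j.val_lt
    exact ZMod.val_injective _ (hp.getVert_injOn' (by simp only [Set.mem_ofPred_eq]; omega)
      (by simp only [Set.mem_ofPred_eq]; omega) hij)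
  · intro i
    have hi := i.val_lt
    have h1 : i + 1 = ((i.val + 1 : ℕ) : ZMod p.length) := by simp
    show G.Adj (p.getVert i.val) (p.getVert (i + 1).val)
    rw [h1, key _ (by omega)]
    exact p.adj_getVert_succ hi

theorem IsCyclicSeq.natCast_inj {m : ℕ} {c : ZMod m → V} (hc : G.IsCyclicSeq m c) (i : ZMod m)
    {s s' : ℕ} (hs : s < m) (hs' : s' < m) (h : c (i + s) = c (i + s')) : s = s' := by
  have h1 := add_left_cancel (hc.1 h)
  rw [ZMod.natCast_eq_natCast_iff'] at h1
  rwa [Nat.mod_eq_of_lt hs, Nat.mod_eq_of_lt hs'] at h1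

theorem IsCyclicSeq.exists_walk {m : ℕ} {c : ZMod m → V} (hc : G.IsCyclicSeq m c) (i : ZMod m)
    (g : ℕ) : ∃ w : G.Walk (c i) (c (i + g)), w.length = g ∧
      w.support = (List.range (g + 1)).map (fun s : ℕ => c (i + s)) := by
  induction g with
  | zero => exact ⟨Walk.nil.copy rfl (by simp), by simp, by simp [Walk.support_copy]⟩
  | succ g ih =>
    obtain ⟨w, hl, hs⟩ := ih
    have ha : G.Adj (c (i + g)) (c (i + (g + 1 : ℕ))) := by
      have := hc.2 (i + g)
      rwa [add_assoc, ← Nat.cast_succ] at this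
    refine ⟨w.concat ha, by simp [hl], ?_⟩
    rw [Walk.support_concat, hs, List.range_succ (n := g + 1), List.map_append]
    simp

/-- The walk along the arc of `c` of length `g` starting at `i`. -/
theorem IsCyclicSeq.exists_path {m : ℕ} {c : ZMod m → V} (hc : G.IsCyclicSeq m c) (i : ZMod m)
    (g : ℕ) (hg : g < m) : ∃ w : G.Walk (c i) (c (i + g)), w.IsPath ∧ w.length = g ∧
      ∀ v, v ∈ w.support ↔ ∃ s ≤ g, v = c (i + (s : ℕ)) := by
  obtain ⟨w, hl, hs⟩ := hc.exists_walk i g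
  refine ⟨w, .mk' ?_, hl, ?_⟩
  · rw [hs]
    refine List.Nodup.map_on ?_ List.nodup_range
    intro a ha b hb hab
    simp only [List.mem_range] at ha hb
    exact hc.natCast_inj i (by omega) (by omega) hab
  · intro v
    rw [hs]
    simp only [List.mem_map, List.mem_range]
    exact ⟨fun ⟨s, h1, h2⟩ => ⟨s, by omega, h2.symm⟩, fun ⟨s, h1, h2⟩ => ⟨s, by omega, h2.symm⟩⟩

theorem Walk.mem_support_tail {u v w : V} {p : G.Walk u v} (hp : p.IsPath)
    (hw : w ∈ p.support.tail) : w ∈ p.support ∧ w ≠ u := by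
  refine ⟨List.mem_of_mem_tail hw, ?_⟩
  rintro rfl
  have := hp.support_nodup
  rw [← p.cons_tail_support] at this
  exact (List.nodup_cons.1 this).1 hw

theorem Walk.IsPath.append_isPath {u v w : V} {p : G.Walk u v} {q : G.Walk v w} (hp : p.IsPath)
    (hq : q.IsPath) (h : ∀ x ∈ p.support, x ∈ q.support → x = v) : (p.append q).IsPath := by
  refine .mk' ?_
  rw [Walk.support_append, List.nodup_append']
  refine ⟨hp.support_nodup, hq.support_nodup.tail, fun x hx hx' => ?_⟩
  obtain ⟨h1, h2⟩ := Walk.mem_support_tail hq hx'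
  exact h2 (h x hx h1)

theorem Walk.IsPath.append_isCycle {u v : V} {p : G.Walk u v} {q : G.Walk v u} (hp : p.IsPath)
    (hq : q.IsPath) (hl : 1 < p.length ∨ 1 < q.length)
    (h : ∀ x ∈ p.support, x ∈ q.support → x = u ∨ x = v) : (p.append q).IsCycle := by
  refine hp.isCycle_append hq (fun x hx hx' => ?_) hl
  obtain ⟨h1, h2⟩ := Walk.mem_support_tail hq hx'
  obtain ⟨h3, h4⟩ := Walk.mem_support_tail hp hx
  exact (h x h3 h1).elim h4 h2

theorem IsCyclicSeq.exists_isCycle {m : ℕ} (hm : 3 ≤ m) {c : ZMod m → V}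
    (hc : G.IsCyclicSeq m c) : ∃ (v : V) (p : G.Walk v v), p.IsCycle ∧ p.length = m ∧
      ∀ w, w ∈ p.support ↔ ∃ i, w = c i := by
  have : NeZero m := ⟨by omega⟩
  obtain ⟨w, hw, hl, hs⟩ := hc.exists_path 0 (m - 1) (by omega)
  have hadj : G.Adj (c (0 + (m - 1 : ℕ))) (c 0) := by
    have h := hc.2 ((m - 1 : ℕ) : ZMod m)
    have h1 : (((m - 1 : ℕ) : ZMod m) + 1) = 0 := by
      rw [← Nat.cast_succ, Nat.succ_eq_add_one, Nat.sub_add_cancel (by omega), ZMod.natCast_self]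
    rwa [h1, ← zero_add ((m - 1 : ℕ) : ZMod m)] at h
  refine ⟨c 0, w.append hadj.toWalk, hw.append_isCycle (by simpa using hadj.ne) (by omega) ?_, ?_, ?_⟩
  · intro x _ hx
    simpa [or_comm] using hx
  · simp [hl]; omega
  · intro v
    rw [Walk.mem_support_append_iff, hs]
    constructor
    · rintro (⟨s, -, rfl⟩ | h)
      · exact ⟨_, rfl⟩
      · simp at h
        rcases h with rfl | rfl
        exacts [⟨_, rfl⟩, ⟨_, rfl⟩]
    · rintro ⟨i, rfl⟩
      have := i.val_lt
      exact Or.inl ⟨i.val, by omega, by simp⟩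

theorem IsCyclicSeq.rotate {m : ℕ} {c : ZMod m → V} (hc : G.IsCyclicSeq m c) (a : ZMod m) :
    G.IsCyclicSeq m (fun i => c (i + a)) := by
  refine ⟨fun i j h => add_right_cancel (hc.1 h), fun i => ?_⟩
  have := hc.2 (i + a)
  rwa [add_right_comm] at this

end SimpleGraph

/-! ### Flexible arcs and the edges that pierce them -/

/-- `x` and `y` are joined by paths of length `g` whose interiors avoid any given `N` vertices. -/
def SimpleGraph.Flexible {V : Type*} (G : SimpleGraph V) (N g : ℕ) (x y : V) : Prop :=
  ∀ H : Finset V, H.card ≤ N → ∃ p : G.Walk x y, p.IsPath ∧ p.length = g ∧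
    ∀ v ∈ p.support, v ∈ H → v = x ∨ v = y

namespace SimpleGraph

variable {V : Type*} {G : SimpleGraph V}

theorem Walk.card_toFinset_support_le [DecidableEq V] {x y : V} (p : G.Walk x y) :
    p.support.toFinset.card ≤ p.length + 1 := by
  rw [← p.length_support]
  exact p.support.toFinset_card_le

theorem Flexible.exists_isCycle {N g : ℕ} {x y : V} (h : G.Flexible N g x y) (hg : 2 ≤ g)
    (hN : g + 1 ≤ N) : ∃ (v : V) (p : G.Walk v v), p.IsCycle ∧ p.length = 2 * g := by
  classical
  obtain ⟨p, hp, hpl, -⟩ := h ∅ (by simp)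
  obtain ⟨q, hq, hql, hpq⟩ := h p.support.toFinset (p.card_toFinset_support_le.trans (by omega))
  refine ⟨x, p.append q.reverse, hp.append_isCycle hq.reverse (by omega) ?_, by simp; omega⟩
  intro v hv hv'
  exact hpq v (by simpa using hv') (by simpa using hv)

/-- Two crossing flexible arcs of a cycle `c`, the first one starting at `i` and of length `g`, the
second one starting `p` steps later and of length `g'`, can be rerouted to a longer cycle. -/
theorem IsCyclicSeq.exists_isCycle_of_crossing {m N : ℕ} [NeZero m] {c : ZMod m → V}
    (hc : G.IsCyclicSeq m c)
    (hN : 2 * m ≤ N) {i : ZMod m} {g p g' : ℕ} (hg : 2 ≤ g) (hgp : g ≤ p) (hpm : p < m)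
    (hmp : m < p + g') (hpg : p + g' < m + g) (h : G.Flexible N g (c i) (c (i + g)))
    (h' : G.Flexible N g' (c (i + p)) (c (i + p + g'))) :
    ∃ (v : V) (w : G.Walk v v), w.IsCycle ∧ w.length = 2 * (p + g') - m := by
  classical
  obtain ⟨d, hd⟩ : ∃ d, p + g' = m + d := ⟨p + g' - m, by omega⟩
  obtain ⟨e, rfl⟩ : ∃ e, p = g + e := ⟨p - g, by omega⟩
  have hi : i + (g + e : ℕ) + g' = i + d := by
    rw [add_assoc, ← Nat.cast_add, hd]; simp
  rw [hi] at h'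
  have hcard : (Finset.univ.image c).card ≤ m := Finset.card_image_le.trans (by simp [ZMod.card])
  obtain ⟨P, hP, hPl, hPc⟩ := h (Finset.univ.image c) (by omega)
  -- `Q` has to avoid `c` and also `P`, at most `m + (g + 1) ≤ 2 * m` vertices in all.
  obtain ⟨Q, hQ, hQl, hQc⟩ := h' (Finset.univ.image c ∪ P.support.toFinset) (by
    refine (Finset.card_union_le _ _).trans ?_
    have := P.card_toFinset_support_le
    omega)
  obtain ⟨W, hW, hWl, hWs⟩ := hc.exists_path i d (by omega)
  have hW'' := hc.exists_path (i + g) e (by omega)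
  have hcast (s : ℕ) : i + (g : ZMod m) + s = i + (g + s : ℕ) := by push_cast; ring
  rw [hcast e] at hW''
  simp only [hcast] at hW''
  obtain ⟨W', hW', hWl', hWs'⟩ := hW''
  have inj {s s' : ℕ} (hs : s < m) (hs' : s' < m) (h : c (i + s) = c (i + s')) : s = s' :=
    hc.natCast_inj i hs hs' h
  have inj0 {s : ℕ} (hs : s < m) (h : c i = c (i + s)) : s = 0 :=
    (inj (s := 0) (by omega) hs (by simpa using h)).symm
  have hPc' {s : ℕ} (hs : s < m) (h : c (i + s) ∈ P.support) : s = 0 ∨ s = g := by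
    rcases hPc _ h (Finset.mem_image_of_mem _ (Finset.mem_univ _)) with h | h
    · exact Or.inl (inj0 hs h.symm)
    · exact Or.inr (inj hs (by omega) h)
  have hQc' {s : ℕ} (hs : s < m) (h : c (i + s) ∈ Q.support) : s = g + e ∨ s = d := by
    rcases hQc _ h (Finset.mem_union_left _ (Finset.mem_image_of_mem _ (Finset.mem_univ _)))
      with h | h
    · exact Or.inl (inj hs (by omega) h)
    · exact Or.inr (inj hs (by omega) h)
  -- The new cycle follows `Q`, goes back along the overlap `W` to `c i`, then takes `P` and the arc
  -- `W'`. Its length is `g' + d + g + e`: the overlap is used in addition to both replaced arcs.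
  have h1 : (Q.append W.reverse).IsPath := by
    refine hQ.append_isPath hW.reverse fun x hx hx' => ?_
    rw [Walk.support_reverse, List.mem_reverse, hWs] at hx'
    obtain ⟨s, hs, rfl⟩ := hx'
    rcases hQc' (by omega) hx with h | h
    · omega
    · rw [h]
  have h2 : (P.append W').IsPath := by
    refine hP.append_isPath hW' fun x hx hx' => ?_
    obtain ⟨s, hs, rfl⟩ := (hWs' _).1 hx'
    rcases hPc' (by omega) hx with h | h
    · omega
    · rw [h]
  refine ⟨_, (Q.append W.reverse).append (P.append W'), h1.append_isCycle h2 ?_ ?_, ?_⟩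
  · simp; omega
  · intro x hx hx'
    rw [Walk.mem_support_append_iff] at hx hx'
    rw [Walk.support_reverse, List.mem_reverse, hWs] at hx
    rw [hWs'] at hx'
    rcases hx with hx | ⟨s, hs, rfl⟩ <;> rcases hx' with hx' | ⟨s', hs', hx'⟩
    · rcases hQc x hx (Finset.mem_union_right _ (by simpa using hx')) with rfl | rfl
      · exact Or.inl rfl
      · rcases hPc' (by omega) hx' with h | h <;> omega
    · subst hx'
      rcases hQc' (by omega) hx with h | h
      · rw [h]; exact Or.inl rfl
      · omega
    · rcases hPc' (by omega) hx' with h | h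
      · subst h; right; simp
      · omega
    · have := inj (by omega) (by omega) hx'
      omega
  · simp; omega

/-- Along a cycle of length at most `k`, the interiors of all flexible arcs can be met by the ends of
`k / l` edges. -/
theorem IsCyclicSeq.exists_piercing {k l m : ℕ} (hm : 3 ≤ m) {c : ZMod m → V}
    (hc : G.IsCyclicSeq m c) (hl : 1 ≤ l) (hlk : l ≤ k)
    (hk : ∀ (v : V) (p : G.Walk v v), p.IsCycle → p.length ≤ k)
    (heven : ∀ (v : V) (p : G.Walk v v), p.IsCycle → Even p.length → 2 * l ≤ p.length) :
    ∃ a : ZMod m, ∀ (i : ZMod m) (g : ℕ), 2 ≤ g → g < m →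
      G.Flexible (2 * k) g (c i) (c (i + g)) → ∃ h < k / l, ∃ s, 0 < s ∧ s < g ∧
        (i + s = a + (h * l : ℕ) ∨ i + s = a + (h * l + 1 : ℕ)) := by
  have : NeZero m := ⟨by omega⟩
  have hmk : m ≤ k := by
    obtain ⟨v, p, hp, rfl, -⟩ := hc.exists_isCycle hm
    exact hk v p hp
  have hlg {i : ZMod m} {g : ℕ} (hg : 2 ≤ g) (hgm : g < m)
      (h : G.Flexible (2 * k) g (c i) (c (i + g))) : l ≤ g := by
    obtain ⟨v, p, hp, hpl⟩ := h.exists_isCycle hg (by omega)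
    have := heven v p hp (by rw [hpl]; exact even_two_mul g)
    omega
  by_cases hex : ∃ g, 2 ≤ g ∧ g < m ∧ ∃ i, G.Flexible (2 * k) g (c i) (c (i + g))
  swap
  · exact ⟨0, fun i g hg hgm h => (hex ⟨g, hg, hgm, i, h⟩).elim⟩
  classical
  obtain ⟨hg0, hgm0, i0, h0⟩ := Nat.find_spec hex
  have hmin (g : ℕ) := @Nat.find_min' _ _ hex g
  generalize Nat.find hex = g0 at *
  -- The first edge is the last edge of a shortest flexible arc, which starts at `i0` and has length
  -- `g0`.
  refine ⟨i0 + (g0 - 1 : ℕ), fun i g hg hgm h => ?_⟩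
  have hle : g0 ≤ g := hmin g ⟨hg, hgm, i, h⟩
  have hl0 := hlg hg0 hgm0 h0
  have hlg' := hlg hg hgm h
  have hkl : 0 < k / l := Nat.div_pos hlk hl
  obtain ⟨p, hp, rfl⟩ : ∃ p < m, i = i0 + (p : ℕ) :=
    ⟨(i - i0).val, (i - i0).val_lt, by simp⟩
  have hcast (a b : ℕ) (hab : a = b ∨ a = b + m) : i0 + (a : ZMod m) = i0 + (b : ZMod m) := by
    rcases hab with rfl | rfl <;> simp
  have fin (x s : ℕ) (hx : x < k / l) (hs : 0 < s) (hsg : s < g)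
      (hxs : p + s = g0 - 1 + x * l ∨ p + s = g0 - 1 + (x * l + 1) ∨
        p + s = g0 - 1 + x * l + m ∨ p + s = g0 - 1 + (x * l + 1) + m) :
      ∃ h < k / l, ∃ s, 0 < s ∧ s < g ∧
        (i0 + (p : ZMod m) + s = i0 + (g0 - 1 : ℕ) + (h * l : ℕ) ∨
          i0 + (p : ZMod m) + s = i0 + (g0 - 1 : ℕ) + (h * l + 1 : ℕ)) := by
    refine ⟨x, hx, s, hs, hsg, ?_⟩
    rw [add_assoc, add_assoc, add_assoc, ← Nat.cast_add, ← Nat.cast_add, ← Nat.cast_add]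
    rcases hxs with h | h | h | h
    · exact Or.inl (hcast _ _ (Or.inl h))
    · exact Or.inr (hcast _ _ (Or.inl h))
    · exact Or.inl (hcast _ _ (Or.inr h))
    · exact Or.inr (hcast _ _ (Or.inr h))
  -- The arcs whose interior meets the first edge: by minimality of `g0`, those starting before
  -- `g0`, and those that wrap round past the first arc's last inner vertex.
  by_cases h1 : p + 2 ≤ g0
  · exact fin 0 (g0 - 1 - p) hkl (by omega) (by omega) (by omega)
  by_cases h2 : p + 1 = g0
  · exact fin 0 1 hkl (by omega) (by omega) (by omega)
  by_cases h3 : m + g0 ≤ p + g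
  · exact fin 0 (m + g0 - 1 - p) hkl (by omega) (by omega) (by omega)
  -- If the arc wraps round, it crosses the first one, and rerouting gives `2 * (p + g) - m ≤ k`;
  -- with `m ≤ k` this yields the claim.
  have hq : p + g ≤ k := by
    by_cases h4 : m < p + g
    · obtain ⟨v, w, hw, hwl⟩ := hc.exists_isCycle_of_crossing (N := 2 * k) (by omega) hg0
        (by omega) hp h4 (by omega) h0 h
      have := hk v w hw
      omega
    · omega
  obtain ⟨y, hy⟩ : ∃ y, p = g0 + y := ⟨p - g0, by omega⟩
  have e1 := Nat.div_add_mod y l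
  have e2 := Nat.mod_lt y hl
  have e3 : (y / l + 1) * l = l * (y / l) + l := by ring
  have hx : y / l + 1 < k / l := by
    have h6 : (y / l + 1).succ * l = l * (y / l) + 2 * l := by rw [Nat.succ_eq_add_one]; ring
    exact (Nat.le_div_iff_mul_le hl).2 (by omega)
  -- The second end of edge `y / l + 1` is the first such end after the start of the arc. It is
  -- interior unless `g = l` and `l ∣ y`, when it is the arc's last vertex and the first end of the
  -- edge is interior instead. This is why edges, not single vertices, are used.
  by_cases h5 : l - y % l < g
  · exact fin (y / l + 1) (l - y % l) hx (by omega) (by omega) (by omega)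
  · exact fin (y / l + 1) (g - 1) hx (by omega) (by omega) (by omega)

end SimpleGraph

/-! ### Counting cycles from above -/

namespace SimpleGraph

variable {V : Type*} {G : SimpleGraph V}

theorem exists_gap {j : ℕ} [NeZero j] (hj : 3 ≤ j) {P : Finset (ZMod j)} (h0 : 0 ∈ P) (h1 : 1 ∈ P)
    (hP : P ≠ Finset.univ) : ∃ i ∈ P, ∃ g, 2 ≤ g ∧ g < j ∧ i + (g : ℕ) ∈ P ∧
      ∀ s, 0 < s → s < g → i + (s : ℕ) ∉ P := by
  obtain ⟨i, hi, hi'⟩ : ∃ i ∈ P, i + 1 ∉ P := by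
    by_contra! hcon
    have hn : ∀ n : ℕ, (n : ZMod j) ∈ P := by
      intro n
      induction n with
      | zero => simpa using h0
      | succ n ih => simpa using hcon _ ih
    refine hP (Finset.eq_univ_of_forall fun x => ?_)
    simpa using hn x.val
  have : Fact (1 < j) := ⟨by omega⟩
  obtain ⟨y, hy, hyi⟩ : ∃ y ∈ P, y ≠ i := by
    by_cases h : i = 0
    · exact ⟨1, h1, h ▸ one_ne_zero⟩
    · exact ⟨0, h0, Ne.symm h⟩
  have hex : ∃ g : ℕ, 0 < g ∧ i + (g : ℕ) ∈ P := ⟨(y - i).val, by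
    rw [Nat.pos_iff_ne_zero, Ne, ZMod.val_eq_zero, sub_eq_zero]; exact hyi, by simpa using hy⟩
  have hlt : Nat.find hex < j := (Nat.find_min' hex (m := (y - i).val) ⟨by
    rw [Nat.pos_iff_ne_zero, Ne, ZMod.val_eq_zero, sub_eq_zero]; exact hyi, by simpa using hy⟩).trans_lt
      (y - i).val_lt
  obtain ⟨ha, hb⟩ := Nat.find_spec hex
  refine ⟨i, hi, Nat.find hex, ?_, hlt, hb, fun s hs hs' h => Nat.find_min hex hs' ⟨hs, h⟩⟩
  by_contra hcon
  have : Nat.find hex = 1 := by omega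
  rw [this] at hb
  exact hi' (by simpa using hb)

/-- The cyclic sequences of length `j` all of whose flexible arcs have an interior point in `S`. -/
def piercedSeqs (G : SimpleGraph V) (N j : ℕ) (S : Finset (ZMod j)) : Set (ZMod j → V) :=
  {c | G.IsCyclicSeq j c ∧ ∀ (i : ZMod j) (g : ℕ), 2 ≤ g → g < j →
    G.Flexible N g (c i) (c (i + g)) → ∃ s : ℕ, 0 < s ∧ s < g ∧ i + s ∈ S}

open Classical in
-- While positions are missing from `P`, some gap between members of `P` has no point of `S` inside.
-- If its ends under `f` are flexible, no sequence qualifies. Otherwise a set `H` of at most `N`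
-- vertices meets the interior of every path of the gap's length between them, so some inner vertex
-- of the arc lies in `H`: at most `j * N` choices of position and value, after which `P` has grown
-- by one.
theorem card_piercedSeqs_extending [Fintype V] {N j : ℕ} [NeZero j] (hj : 3 ≤ j)
    {S : Finset (ZMod j)} (h0 : 0 ∈ S) (h1 : 1 ∈ S) (r : ℕ) (P : Finset (ZMod j)) (hSP : S ⊆ P)
    (hr : j - P.card = r) (f : ZMod j → V) :
    (Finset.univ.filter fun c : ZMod j → V => c ∈ G.piercedSeqs N j S ∧ ∀ i ∈ P, c i = f i).card
      ≤ (j * N) ^ r := by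
  induction r generalizing P f with
  | zero =>
    have hP : P = Finset.univ := by
      rw [← Finset.card_eq_iff_eq_univ, ZMod.card]
      have := Finset.card_le_univ P
      rw [ZMod.card] at this
      omega
    rw [pow_zero, Finset.card_le_one]
    intro a ha b hb
    simp only [Finset.mem_filter, hP, Finset.mem_univ, true_and, forall_const] at ha hb
    ext i
    rw [ha.2, hb.2]
  | succ r ih =>
    have hP : P ≠ Finset.univ := by
      rintro rfl
      rw [Finset.card_univ, ZMod.card] at hr
      omega
    obtain ⟨i, hi, g, hg, hgj, hig, hgap⟩ := exists_gap hj (hSP h0) (hSP h1) hP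
    by_cases hflex : G.Flexible N g (f i) (f (i + g))
    · rw [Finset.card_eq_zero.2]
      · exact Nat.zero_le _
      rw [Finset.filter_eq_empty_iff]
      rintro c - ⟨⟨-, hc⟩, hcf⟩
      rw [← hcf _ hi, ← hcf _ hig] at hflex
      obtain ⟨s, hs, hsg, hsS⟩ := hc i g hg hgj hflex
      exact hgap s hs hsg (hSP hsS)
    · simp only [Flexible, not_forall] at hflex
      obtain ⟨H, hH, hno⟩ := hflex
      have hsub : (Finset.univ.filter fun c : ZMod j → V =>
          c ∈ G.piercedSeqs N j S ∧ ∀ i ∈ P, c i = f i) ⊆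
          (Finset.Ioo 0 g ×ˢ H).biUnion fun x => Finset.univ.filter fun c : ZMod j → V =>
            c ∈ G.piercedSeqs N j S ∧
              ∀ y ∈ insert (i + (x.1 : ZMod j)) P, c y = Function.update f (i + x.1) x.2 y := by
        intro c hc
        simp only [Finset.mem_filter, Finset.mem_univ, true_and] at hc
        obtain ⟨hc, hcf⟩ := hc
        have hpath := hc.1.exists_path i g hgj
        rw [hcf _ hi, hcf _ hig] at hpath
        obtain ⟨w, hw, hwl, hws⟩ := hpath
        by_contra hcon
        refine hno ⟨w, hw, hwl, fun v hv hvH => ?_⟩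
        obtain ⟨s, hs, rfl⟩ := (hws v).1 hv
        rcases Nat.eq_zero_or_pos s with rfl | hs0
        · left; rw [Nat.cast_zero, add_zero, hcf _ hi]
        rcases hs.lt_or_eq with hsg | rfl
        · refine (hcon ?_).elim
          rw [Finset.mem_biUnion]
          refine ⟨(s, c (i + s)), by simp [hs0, hsg, hvH], ?_⟩
          simp only [Finset.mem_filter, Finset.mem_univ, true_and]
          refine ⟨hc, fun y hy => ?_⟩
          by_cases h : y = i + s
          · subst h; simp
          · rw [Function.update_of_ne h]
            exact hcf y ((Finset.mem_insert.1 hy).resolve_left h)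
        · right; rw [hcf _ hig]
      refine (Finset.card_le_card hsub).trans ?_
      refine (Finset.card_biUnion_le_card_mul _ _ ((j * N) ^ r) ?_).trans ?_
      · rintro ⟨s, h⟩ hx
        simp only [Finset.mem_product, Finset.mem_Ioo] at hx
        refine ih _ (hSP.trans (Finset.subset_insert _ _)) ?_ _
        rw [Finset.card_insert_of_notMem (hgap s hx.1.1 hx.1.2)]
        omega
      · rw [pow_succ, mul_comm]
        refine Nat.mul_le_mul_left _ ?_
        rw [Finset.card_product, Nat.card_Ioo]
        exact Nat.mul_le_mul (by omega) hH

/-- All neighbours of an end of a longest path lie on the path, and one further than `k - 1` steps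
along it would close a cycle longer than `k`. -/
theorem exists_card_neighbors_le [Fintype V] [Nonempty V] {k : ℕ}
    (hk : ∀ (v : V) (p : G.Walk v v), p.IsCycle → p.length ≤ k) (hk1 : 1 ≤ k) :
    ∃ v, ∃ s : Finset V, s.card ≤ k ∧ ∀ w, G.Adj v w → w ∈ s := by
  classical
  obtain ⟨u, v, p, hp, hmax⟩ := Walk.exists_isPath_forall_isPath_length_le_length G
  refine ⟨u, (Finset.Icc 1 k).image p.getVert, Finset.card_image_le.trans (by simp), fun w hw => ?_⟩
  have hwp : w ∈ p.support := by
    by_contra hcon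
    have := hmax _ _ _ (hp.cons hcon (h := hw.symm))
    simp at this
  rw [Finset.mem_image]
  refine ⟨(p.takeUntil w hwp).length, ?_, p.getVert_length_takeUntil hwp⟩
  have hpos : (p.takeUntil w hwp).length ≠ 0 := fun h => hw.ne (Walk.eq_of_length_eq_zero h)
  rw [Finset.mem_Icc]
  refine ⟨by omega, ?_⟩
  by_cases h2 : 1 < (p.takeUntil w hwp).length
  · have := hk u _ ((hp.takeUntil hwp).append_isCycle (q := hw.symm.toWalk) (by simpa using hw.ne')
      (Or.inl h2) (by intro x _ hx; simpa [or_comm] using hx))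
    simp at this
    omega
  · omega

open Classical in
-- Remove vertices of degree at most `k` one by one; each accounts for at most `2 * k` ordered
-- pairs.
theorem card_adj_pairs_le [Fintype V] {k : ℕ}
    (hk : ∀ (v : V) (p : G.Walk v v), p.IsCycle → p.length ≤ k) (hk1 : 1 ≤ k) (n : ℕ)
    (A : Finset V) (hA : A.card = n) :
    ((A ×ˢ A).filter fun x => G.Adj x.1 x.2).card ≤ 2 * k * n := by
  induction n generalizing A with
  | zero => simp [Finset.card_eq_zero.1 hA]
  | succ n ih =>
    have hne : Nonempty A := by
      rw [Finset.nonempty_coe_sort, ← Finset.card_pos]; omega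
    obtain ⟨v, s, hs, hsv⟩ := exists_card_neighbors_le (G := G.comap ((↑) : A → V)) (k := k)
      (fun v p hp => by
        have := hk _ _ (hp.map (f := (Hom.comap ((↑) : A → V) G)) Subtype.val_injective)
        rwa [Walk.length_map] at this) hk1
    have hsub : ((A ×ˢ A).filter fun x => G.Adj x.1 x.2) ⊆
        (((A.erase v) ×ˢ (A.erase v)).filter fun x => G.Adj x.1 x.2) ∪
          (s.image (fun w : A => ((v : V), (w : V))) ∪ s.image (fun w : A => ((w : V), (v : V)))) := by
      rintro ⟨x, y⟩ hxy
      simp only [Finset.mem_filter, Finset.mem_product] at hxy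
      obtain ⟨⟨hx, hy⟩, hxy⟩ := hxy
      simp only [Finset.mem_union, Finset.mem_filter, Finset.mem_product, Finset.mem_erase,
        Finset.mem_image]
      by_cases h1 : x = v
      · exact Or.inr (Or.inl ⟨⟨y, hy⟩, hsv _ (by simpa [← h1] using hxy), by rw [h1]⟩)
      · by_cases h2 : y = v
        · exact Or.inr (Or.inr ⟨⟨x, hx⟩, hsv _ (by simpa [← h2] using hxy.symm), by rw [h2]⟩)
        · exact Or.inl ⟨⟨⟨h1, hx⟩, h2, hy⟩, hxy⟩
    have e1 := ih (A.erase v) (by rw [Finset.card_erase_of_mem v.2]; omega)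
    have e2 : (s.image (fun w : A => ((v : V), (w : V)))).card ≤ s.card := Finset.card_image_le
    have e3 : (s.image (fun w : A => ((w : V), (v : V)))).card ≤ s.card := Finset.card_image_le
    refine (Finset.card_le_card hsub).trans ((Finset.card_union_le _ _).trans ?_)
    have e4 := Finset.card_union_le (s.image (fun w : A => ((v : V), (w : V))))
      (s.image (fun w : A => ((w : V), (v : V))))
    have e5 : 2 * k * (n + 1) = 2 * k * n + 2 * k := by ring
    omega

/-- The cycle traced out by `c`. -/
def cyclicSubgraph (G : SimpleGraph V) {m : ℕ} (c : ZMod m → V) : G.Subgraph where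
  verts := Set.range c
  Adj u v := G.Adj u v ∧ ∃ i, s(c i, c (i + 1)) = s(u, v)
  adj_sub h := h.1
  edge_vert := by
    rintro u v ⟨-, i, h⟩
    rcases Sym2.eq_iff.1 h with h | h
    exacts [⟨_, h.1⟩, ⟨_, h.2⟩]
  symm := ⟨fun u v ⟨h, i, h'⟩ => ⟨h.symm, i, h'.trans Sym2.eq_swap⟩⟩

theorem cyclicSubgraph_rotate {m : ℕ} (c : ZMod m → V) (a : ZMod m) :
    G.cyclicSubgraph (fun i => c (i + a)) = G.cyclicSubgraph c := by
  ext u v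
  · simp only [cyclicSubgraph, Set.mem_range]
    exact ⟨fun ⟨i, h⟩ => ⟨_, h⟩, fun ⟨i, h⟩ => ⟨i - a, by simpa using h⟩⟩
  · simp only [cyclicSubgraph]
    refine and_congr_right fun _ => ⟨fun ⟨i, h⟩ => ⟨i + a, ?_⟩, fun ⟨i, h⟩ => ⟨i - a, ?_⟩⟩
    · rwa [add_right_comm] at h
    · rw [add_right_comm]; simpa using h

theorem Walk.toSubgraph_eq_cyclicSubgraph {v : V} {p : G.Walk v v} (hp : p.IsCycle)
    {c : ZMod p.length → V} (hc : ∀ i ≤ p.length, c (i : ℕ) = p.getVert i) :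
    p.toSubgraph = G.cyclicSubgraph c := by
  have : NeZero p.length := ⟨by have := hp.three_le_length; omega⟩
  ext u w
  · rw [Walk.mem_verts_toSubgraph, Walk.mem_support_iff_exists_getVert]
    simp only [cyclicSubgraph, Set.mem_range]
    constructor
    · rintro ⟨i, h, hi⟩
      exact ⟨i, by rw [hc i hi, h]⟩
    · rintro ⟨i, h⟩
      exact ⟨i.val, by rw [← hc _ i.val_lt.le]; simpa using h, i.val_lt.le⟩
  · rw [Walk.toSubgraph_adj_iff]
    simp only [cyclicSubgraph]
    constructor
    · rintro ⟨i, h, hi⟩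
      rw [← hc i hi.le, ← hc (i + 1) hi, Nat.cast_succ] at h
      refine ⟨?_, i, h⟩
      rw [← G.mem_edgeSet, ← h, G.mem_edgeSet, ← Nat.cast_succ, hc i hi.le, hc (i + 1) hi]
      exact p.adj_getVert_succ hi
    · rintro ⟨-, i, h⟩
      refine ⟨i.val, ?_, i.val_lt⟩
      rw [← hc _ i.val_lt.le, ← hc _ i.val_lt, ← h]
      simp

/-- The ends of `t` edges of a cycle, any two consecutive ones at distance `l`. -/
def spacedEdgeEnds (j l t : ℕ) : Finset (ZMod j) :=
  (Finset.range t).image (fun h : ℕ => ((h * l : ℕ) : ZMod j)) ∪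
    (Finset.range t).image (fun h : ℕ => ((h * l + 1 : ℕ) : ZMod j))

open Classical in
-- Map a sequence to the images of its `t` spaced edges: sparsity bounds the number of values, and
-- `card_piercedSeqs_extending` bounds each fibre.
theorem card_piercedSeqs_le [Fintype V] {k N j l t : ℕ} [NeZero j] (hj : 3 ≤ j) (hjk : j ≤ k)
    (ht : 0 < t) (hN : 1 ≤ N)
    (hk : ∀ (v : V) (p : G.Walk v v), p.IsCycle → p.length ≤ k) :
    (Finset.univ.filter fun c : ZMod j → V => c ∈ G.piercedSeqs N j (spacedEdgeEnds j l t)).card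
      ≤ (k * N) ^ k * (2 * k * Fintype.card V) ^ t := by
  set E := ((Finset.univ ×ˢ Finset.univ : Finset (V × V)).filter fun x => G.Adj x.1 x.2) with hE
  have hEc : E.card ≤ 2 * k * Fintype.card V :=
    card_adj_pairs_le hk (by omega) _ Finset.univ Finset.card_univ
  let F : (ZMod j → V) → Fin t → V × V := fun c h =>
    (c ((h * l : ℕ) : ZMod j), c ((h * l + 1 : ℕ) : ZMod j))
  have hcard : (Fintype.piFinset fun _ : Fin t => E).card = E.card ^ t := by simp
  refine (Finset.card_le_mul_card_image_of_maps_to (f := F)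
    (t := Fintype.piFinset fun _ : Fin t => E) ?_ ((k * N) ^ k) ?_).trans ?_
  · intro c hc
    simp only [Finset.mem_filter, Finset.mem_univ, true_and] at hc
    rw [Fintype.mem_piFinset]
    intro h
    simp only [hE, F, Finset.mem_filter, Finset.mem_product, Finset.mem_univ, true_and]
    simpa using hc.1.2 ((h * l : ℕ) : ZMod j)
  · intro b _
    rcases Finset.eq_empty_or_nonempty (Finset.filter (fun c => F c = b) (Finset.univ.filter
      fun c : ZMod j → V => c ∈ G.piercedSeqs N j (spacedEdgeEnds j l t))) with h | ⟨f, hf⟩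
    · rw [h]; simp
    · simp only [Finset.mem_filter, Finset.mem_univ, true_and] at hf
      refine (Finset.card_le_card ?_).trans ((card_piercedSeqs_extending hj (N := N)
        (S := spacedEdgeEnds j l t) (G := G) ?_ ?_ _ _ le_rfl rfl f).trans ?_)
      · intro c hc
        simp only [Finset.mem_filter, Finset.mem_univ, true_and] at hc ⊢
        refine ⟨hc.1, fun i hi => ?_⟩
        simp only [spacedEdgeEnds, Finset.mem_union, Finset.mem_image, Finset.mem_range] at hi
        rcases hi with ⟨h, hh, rfl⟩ | ⟨h, hh, rfl⟩
        · exact congrArg Prod.fst (congrFun (hc.2.trans hf.2.symm) ⟨h, hh⟩)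
        · exact congrArg Prod.snd (congrFun (hc.2.trans hf.2.symm) ⟨h, hh⟩)
      · simp only [spacedEdgeEnds, Finset.mem_union, Finset.mem_image, Finset.mem_range]
        exact Or.inl ⟨0, ht, by simp⟩
      · simp only [spacedEdgeEnds, Finset.mem_union, Finset.mem_image, Finset.mem_range]
        exact Or.inr ⟨0, ht, by simp⟩
      · refine (Nat.pow_le_pow_left (Nat.mul_le_mul_right N hjk) _).trans
          (Nat.pow_le_pow_right (Nat.mul_pos (by omega) hN) (by omega))
  · rw [hcard]
    exact Nat.mul_le_mul_left _ (Nat.pow_le_pow_left hEc t)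

theorem ncard_cycleSubgraphs_le [Fintype V] {k l : ℕ} (hl : 1 ≤ l) (hlk : l ≤ k)
    (hk : ∀ (v : V) (p : G.Walk v v), p.IsCycle → p.length ≤ k)
    (heven : ∀ (v : V) (p : G.Walk v v), p.IsCycle → Even p.length → 2 * l ≤ p.length) :
    G.cycleSubgraphs.ncard ≤
      (k + 1) * ((k * (2 * k)) ^ k * (2 * k * Fintype.card V) ^ (k / l)) := by
  classical
  set T : Finset G.Subgraph := (Finset.Icc 3 k).biUnion fun j =>
    -- The case `j = 0` never occurs in the range; the split only supplies `NeZero j`, which makes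
    -- `ZMod j` finite.
    if hj : j = 0 then ∅ else
      haveI : NeZero j := ⟨hj⟩
      (Finset.univ.filter fun c : ZMod j → V =>
        c ∈ G.piercedSeqs (2 * k) j (spacedEdgeEnds j l (k / l))).image G.cyclicSubgraph with hT
  have hsub : G.cycleSubgraphs ⊆ T := by
    rintro H ⟨v, p, hp, rfl⟩
    obtain ⟨c, hc, hcp⟩ := hp.exists_isCyclicSeq
    have h3 := hp.three_le_length
    obtain ⟨a, ha⟩ := hc.exists_piercing h3 hl hlk hk heven
    rw [Walk.toSubgraph_eq_cyclicSubgraph hp hcp, ← cyclicSubgraph_rotate c a, hT,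
      Finset.coe_biUnion, Set.mem_iUnion₂]
    refine ⟨p.length, by simpa using ⟨h3, hk v p hp⟩, ?_⟩
    rw [dif_neg (by omega), Finset.mem_coe]
    refine Finset.mem_image_of_mem _ ?_
    simp only [Finset.mem_filter, Finset.mem_univ, true_and]
    refine ⟨hc.rotate a, fun i g hg hgm h => ?_⟩
    beta_reduce at h
    rw [add_right_comm] at h
    obtain ⟨x, hx, s, hs, hsg, h⟩ := ha _ g hg hgm h
    refine ⟨s, hs, hsg, ?_⟩
    simp only [spacedEdgeEnds, Finset.mem_union, Finset.mem_image, Finset.mem_range]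
    refine h.imp (fun h => ⟨x, hx, ?_⟩) fun h => ⟨x, hx, ?_⟩
    all_goals
      rw [add_right_comm, add_comm] at h
      exact (add_left_cancel h).symm
  refine (Set.ncard_le_ncard hsub T.finite_toSet).trans ?_
  rw [Set.ncard_coe_finset]
  refine (Finset.card_biUnion_le_card_mul _ _
    ((k * (2 * k)) ^ k * (2 * k * Fintype.card V) ^ (k / l)) fun j hj => ?_).trans ?_
  · rw [Finset.mem_Icc] at hj
    rw [dif_neg (by omega)]
    have : NeZero j := ⟨by omega⟩
    refine Finset.card_image_le.trans ?_
    exact card_piercedSeqs_le hj.1 hj.2 (Nat.div_pos hlk hl) (by omega) hk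
  · exact Nat.mul_le_mul_right _ (by simp; omega)

end SimpleGraph

/-! ### The construction: a cycle with bundled arcs -/

/-- The positions on a cycle of length `k` lying in the interiors of `k / l` consecutive arcs of
length `l`. -/
def IsBundlePos (k l : ℕ) (p : ZMod k) : Prop :=
  p.val % l ≠ 0 ∧ p.val < k / l * l

theorem ZMod.val_add_one_eq {k : ℕ} [NeZero k] (p : ZMod k) : (p + 1).val = (p.val + 1) % k := by
  have : p + 1 = ((p.val + 1 : ℕ) : ZMod k) := by simp
  rw [this, ZMod.val_natCast]

theorem IsBundlePos.val_add_one {k l : ℕ} [NeZero k] {p : ZMod k} (h : IsBundlePos k l (p + 1)) :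
    (p + 1).val = p.val + 1 := by
  have h1 := p.val_lt
  have h2 := ZMod.val_add_one_eq p
  rcases Nat.lt_or_eq_of_le (Nat.succ_le_of_lt h1) with h3 | h3
  · rw [h2, Nat.mod_eq_of_lt h3]
  · rw [← Nat.succ_eq_add_one, h3, Nat.mod_self] at h2
    exact (h.1 (by rw [h2]; simp)).elim

/-- A cycle of length `k` in which the interiors of `k / l` consecutive arcs of length `l` are
multiplied, the copies being distinguished by their labels. -/
def bundledCycle {V : Type*} {k : ℕ} (l : ℕ) (pos : V → ZMod k) (lab : V → ℕ) : SimpleGraph V :=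
  SimpleGraph.fromRel fun u v => pos v = pos u + 1 ∧ (¬IsBundlePos k l (pos u) → lab u = 0) ∧
    (¬IsBundlePos k l (pos v) → lab v = 0) ∧
    (IsBundlePos k l (pos u) → IsBundlePos k l (pos v) → lab u = lab v)

section bundledCycle

variable {V : Type*} {k l : ℕ} {pos : V → ZMod k} {lab : V → ℕ}

theorem pos_of_bundledCycle_adj {u v : V} (h : (bundledCycle l pos lab).Adj u v) :
    pos v = pos u + 1 ∨ pos u = pos v + 1 := by
  rw [bundledCycle, SimpleGraph.fromRel_adj] at h
  exact h.2.imp And.left And.left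

theorem lab_of_bundledCycle_adj {u v : V} (h : (bundledCycle l pos lab).Adj u v)
    (hv : ¬IsBundlePos k l (pos v)) : lab v = 0 := by
  rw [bundledCycle, SimpleGraph.fromRel_adj] at h
  rcases h.2 with h | h
  · exact h.2.2.1 hv
  · exact h.2.1 hv

theorem lab_eq_of_bundledCycle_adj {u v : V} (h : (bundledCycle l pos lab).Adj u v)
    (hu : IsBundlePos k l (pos u)) (hv : IsBundlePos k l (pos v)) : lab v = lab u := by
  rw [bundledCycle, SimpleGraph.fromRel_adj] at h
  rcases h.2 with h | h
  · exact (h.2.2.2 hu hv).symm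
  · exact h.2.2.2 hv hu

variable (hinj : ∀ u v, pos u = pos v → lab u = lab v → u = v)
include hinj

/-- Outside the bundles only label `0` is attached to anything, so each such position carries a
single non-isolated vertex. -/
theorem eq_of_not_isBundlePos {u v u' v' : V} (h : (bundledCycle l pos lab).Adj v u)
    (h' : (bundledCycle l pos lab).Adj v' u') (hp : pos u = pos u')
    (hu : ¬IsBundlePos k l (pos u)) : u = u' :=
  hinj _ _ hp <| by rw [lab_of_bundledCycle_adj h hu, lab_of_bundledCycle_adj h' (hp ▸ hu)]

theorem eq_of_isBundlePos {u v u' : V} (h : (bundledCycle l pos lab).Adj v u)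
    (h' : (bundledCycle l pos lab).Adj v u') (hp : pos u = pos u')
    (hv : IsBundlePos k l (pos v)) : u = u' := by
  by_cases hu : IsBundlePos k l (pos u)
  · exact hinj _ _ hp <| by
      rw [lab_eq_of_bundledCycle_adj h hv hu, lab_eq_of_bundledCycle_adj h' hv (hp ▸ hu)]
  · exact eq_of_not_isBundlePos hinj h h' hp hu

/-- Inside a bundle a vertex has at most one neighbour at each adjacent position, so a walk that
enters an arc and does not turn back runs to its end. -/
theorem pos_of_straight [NeZero k] {f : ℕ → V}
    (hf : ∀ i, (bundledCycle l pos lab).Adj (f i) (f (i + 1))) (hne : ∀ i, f i ≠ f (i + 2)) {h : ℕ}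
    (hh : h < k / l) (h0 : pos (f 0) = (h * l : ℕ)) (h1 : pos (f 1) = (h * l + 1 : ℕ)) (e : ℕ)
    (he : e + 1 ≤ l) : pos (f e) = (h * l + e : ℕ) ∧ pos (f (e + 1)) = (h * l + (e + 1) : ℕ) := by
  induction e with
  | zero => exact ⟨h0, h1⟩
  | succ e ih =>
    obtain ⟨ih1, ih2⟩ := ih (by omega)
    refine ⟨ih2, ?_⟩
    have hlt : h * l + l ≤ k / l * l := by
      rw [← Nat.succ_mul]; exact Nat.mul_le_mul_right _ hh
    have hlt' := Nat.div_mul_le_self k l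
    have hb : IsBundlePos k l (pos (f (e + 1))) := by
      have hval : h * l + (e + 1) < k := by omega
      have hmod : (h * l + (e + 1)) % l = e + 1 := by
        rw [Nat.mul_comm, Nat.mul_add_mod, Nat.mod_eq_of_lt (by omega)]
      rw [ih2, IsBundlePos, ZMod.val_natCast, Nat.mod_eq_of_lt hval, hmod]
      omega
    rcases pos_of_bundledCycle_adj (hf (e + 1)) with h' | h'
    · rw [h', ih2]; push_cast; ring
    · refine (hne e (eq_of_isBundlePos hinj (hf e).symm (hf (e + 1)) ?_ hb)).elim
      rw [ih2] at h'
      rw [ih1]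
      refine add_right_cancel (b := 1) ?_
      rw [← h']; push_cast; ring

/-- A vertex from which both directions ascend must be the start of a bundled arc. Both directions
then run through copies of that arc and meet at its unique end after `l` steps. -/
theorem length_of_valley [NeZero k] (hl : 2 ≤ l) (hlk : 2 * l ≤ k) {m : ℕ} (hm : 3 ≤ m)
    {c : ZMod m → V} (hc : (bundledCycle l pos lab).IsCyclicSeq m c) {i : ZMod m}
    (h1 : pos (c (i + 1)) = pos (c i) + 1) (h2 : pos (c (i - 1)) = pos (c i) + 1) :
    m = 2 * l := by
  have htwo : ∀ x : ZMod m, x ≠ x + 2 := by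
    intro x hx
    have : ((2 : ℕ) : ZMod m) = 0 := by simpa using hx.symm
    rw [ZMod.natCast_eq_zero_iff] at this
    exact absurd (Nat.le_of_dvd (by omega) this) (by omega)
  have hadj := hc.2 i
  have hadj' : (bundledCycle l pos lab).Adj (c i) (c (i - 1)) := by
    have := hc.2 (i - 1); rw [sub_add_cancel] at this; exact this.symm
  have hne : c (i - 1) ≠ c (i + 1) := fun h => htwo (i - 1) ((hc.1 h).trans (by ring))
  have hnb : ¬IsBundlePos k l (pos (c i)) := fun hb =>
    hne (eq_of_isBundlePos hinj hadj' hadj (h2.trans h1.symm) hb)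
  have hb : IsBundlePos k l (pos (c i) + 1) := by
    by_contra hb
    exact hne (eq_of_not_isBundlePos hinj hadj' hadj (h2.trans h1.symm) (h2 ▸ hb))
  have hv := hb.val_add_one
  have hb2 := hb.2
  have hmod : (pos (c i)).val % l = 0 := by
    by_contra hcon
    exact hnb ⟨hcon, by omega⟩
  obtain ⟨h, hh⟩ := Nat.dvd_of_mod_eq_zero hmod
  rw [mul_comm] at hh
  have hhk : h < k / l := by
    by_contra! hcon
    have := Nat.mul_le_mul_right l hcon
    omega
  have hs : pos (c i) = (h * l : ℕ) := by rw [← hh]; simp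
  have run1 := pos_of_straight hinj (f := fun e : ℕ => c (i + e))
    (fun e => by simpa [add_assoc] using hc.2 (i + e))
    (fun e he => htwo _ ((hc.1 he).trans (by push_cast; ring))) hhk (by simpa using hs)
    (by simp [h1, hs])
  have run2 := pos_of_straight hinj (f := fun e : ℕ => c (i - e))
    (fun e => by
      have := (hc.2 (i - (e + 1 : ℕ))).symm
      rwa [show i - ((e + 1 : ℕ) : ZMod m) + 1 = i - e by push_cast; ring] at this)
    (fun e he => htwo _ ((hc.1 he).symm.trans (by push_cast; ring))) hhk (by simpa using hs)
    (by simp [h2, hs])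
  have e1 := (run1 (l - 1) (by omega)).2
  have e2 := (run2 (l - 1) (by omega)).2
  rw [Nat.sub_add_cancel (by omega)] at e1 e2
  have hend : c (i + l) = c (i - l) := by
    have ha : (bundledCycle l pos lab).Adj (c (i + l - 1)) (c (i + l)) := by
      simpa using hc.2 (i + l - 1)
    refine eq_of_not_isBundlePos hinj ha (hc.2 (i - l)).symm (e1.trans e2.symm) ?_
    rw [e1]
    rintro ⟨hb1, hb2⟩
    rw [ZMod.val_natCast] at hb1
    have hle : h * l + l ≤ k := by
      rw [← Nat.succ_mul]
      exact (Nat.mul_le_mul_right _ hhk).trans (Nat.div_mul_le_self k l)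
    rcases hle.lt_or_eq with h3 | h3
    · rw [Nat.mod_eq_of_lt h3] at hb1
      simp at hb1
    · rw [h3] at hb1
      simp at hb1
  have hdvd : m ∣ 2 * l := by
    have h3 := hc.1 hend
    rw [← ZMod.natCast_eq_zero_iff]
    push_cast
    linear_combination h3
  obtain ⟨d, hd⟩ := hdvd
  have hd0 : d ≠ 0 := by rintro rfl; omega
  -- A proper divisor would give `m ≤ l`: the run would be back at its start while its position had
  -- advanced by `m < k`.
  by_contra hcon
  have hd1 : d ≠ 1 := by rintro rfl; omega
  have hml : m ≤ l := by
    have : m * 2 ≤ m * d := Nat.mul_le_mul_left _ (by omega)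
    omega
  have e3 := (run1 (m - 1) (by omega)).2
  rw [Nat.sub_add_cancel (by omega), ZMod.natCast_self, add_zero, hs, Nat.cast_add] at e3
  have e4 : ((m : ℕ) : ZMod k) = 0 := by simpa using e3.symm
  rw [ZMod.natCast_eq_zero_iff] at e4
  have := Nat.le_of_dvd (by omega) e4
  omega

/-- Returning to the start forces `k ∣ m`. Conversely, position `0` carries one usable vertex, and
visits to it `k` steps apart coincide, so `m ∣ k`. -/
theorem length_of_monotone [NeZero k] {m : ℕ} {c : ZMod m → V}
    (hc : (bundledCycle l pos lab).IsCyclicSeq m c) {ε : ZMod k} (hε : ε * ε = 1)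
    (h : ∀ i, pos (c (i + 1)) = pos (c i) + ε) : m = k := by
  have hn : ∀ n : ℕ, pos (c n) = pos (c 0) + ε * n := by
    intro n
    induction n with
    | zero => simp
    | succ n ih => rw [Nat.cast_succ, h, ih]; push_cast; ring
  have hkm : k ∣ m := by
    have h1 := hn m
    rw [ZMod.natCast_self] at h1
    have h2 : ε * (m : ZMod k) = 0 := by simpa using h1.symm
    rw [← ZMod.natCast_eq_zero_iff, ← one_mul (m : ZMod k), ← hε, mul_assoc, h2, mul_zero]
  refine Nat.dvd_antisymm ?_ hkm
  set n := (-ε * pos (c 0)).val with hndef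
  have h0 : pos (c n) = 0 := by
    rw [hn, hndef, ZMod.natCast_zmod_val]
    linear_combination -pos (c 0) * hε
  have h0' : pos (c (n + k : ℕ)) = 0 := by
    rw [hn, Nat.cast_add, mul_add, ← add_assoc, ← hn, h0]; simp
  have ha (x : ZMod m) : (bundledCycle l pos lab).Adj (c (x - 1)) (c x) := by
    simpa using hc.2 (x - 1)
  have := hc.1 (eq_of_not_isBundlePos hinj (ha _) (ha _) (h0.trans h0'.symm)
    (fun hb => hb.1 (by rw [h0]; simp)))
  rw [← ZMod.natCast_eq_zero_iff]
  simpa using this.symm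

theorem length_of_isCycle_bundledCycle [NeZero k] (hl : 2 ≤ l) (hlk : 2 * l ≤ k) {v : V}
    {p : (bundledCycle l pos lab).Walk v v} (hp : p.IsCycle) : p.length = k ∨ p.length = 2 * l := by
  obtain ⟨c, hc, -⟩ := hp.exists_isCyclicSeq
  have h3 := hp.three_le_length
  generalize p.length = m at *
  have : NeZero m := ⟨by omega⟩
  by_cases hval : ∃ i, pos (c (i + 1)) = pos (c i) + 1 ∧ pos (c (i - 1)) = pos (c i) + 1
  · obtain ⟨i, h1, h2⟩ := hval
    exact Or.inr (length_of_valley hinj hl hlk h3 hc h1 h2)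
  left
  by_cases hup : ∀ i, pos (c (i + 1)) = pos (c i) + 1
  · exact length_of_monotone hinj hc (one_mul 1) hup
  push Not at hup
  obtain ⟨i, hi⟩ := hup
  -- Without a valley, a descending step can only be followed by another one, so the whole cycle
  -- descends.
  have hdown : ∀ n : ℕ, pos (c (i + n)) = pos (c (i + n + 1)) + 1 := by
    intro n
    induction n with
    | zero => simpa using (pos_of_bundledCycle_adj (hc.2 i)).resolve_left hi
    | succ n ih =>
      refine (pos_of_bundledCycle_adj (hc.2 _)).resolve_left fun h => hval ⟨_, h, ?_⟩
      rw [Nat.cast_succ, ← add_assoc, add_sub_cancel_right]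
      exact ih
  refine length_of_monotone hinj hc (ε := -1) (by ring) fun j => ?_
  have := hdown (j - i).val
  rw [ZMod.natCast_zmod_val, add_sub_cancel] at this
  rw [this]
  ring

end bundledCycle

theorem IsBundlePos.div_lt {k l : ℕ} {p : ZMod k} (h : IsBundlePos k l p) : p.val / l < k / l :=
  Nat.div_lt_of_lt_mul (by rw [mul_comm]; exact h.2)

open Classical in
theorem exists_isLCycleGraph_pow_le {k l n : ℕ} (hl : 2 ≤ l) (hlk : 2 * l ≤ k) :
    ∃ G : SimpleGraph (Fin n), (∀ (v : Fin n) (p : G.Walk v v), p.IsCycle →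
      p.length = k ∨ p.length = 2 * l) ∧ (n / k) ^ (k / l) ≤ G.cycleSubgraphs.ncard := by
  have : NeZero k := ⟨by omega⟩
  set pos : Fin n → ZMod k := fun v => ((v : ℕ) : ZMod k) with hpos
  set lab : Fin n → ℕ := fun v => v / k with hlab
  have hinj : ∀ u v, pos u = pos v → lab u = lab v → u = v := by
    intro u v h1 h2
    rw [ZMod.natCast_eq_natCast_iff'] at h1
    ext
    rw [← Nat.div_add_mod u k, ← Nat.div_add_mod v k, h1]
    exact congrArg (fun x => k * x + _) h2
  refine ⟨bundledCycle l pos lab, fun v p hp => length_of_isCycle_bundledCycle hinj hl hlk hp, ?_⟩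
  rcases Nat.eq_zero_or_pos (n / k) with hM | hM
  · rw [hM, zero_pow (Nat.div_pos (by omega) (by omega)).ne']
    exact Nat.zero_le _
  set M := n / k with hMdef
  -- `α` picks one copy of each bundled arc; the other positions get the only usable label, `0`.
  let label (α : Fin (k / l) → Fin M) (p : ZMod k) : Fin M :=
    if h : IsBundlePos k l p then α ⟨p.val / l, h.div_lt⟩ else ⟨0, hM⟩
  have hlt (x : Fin M) (p : ZMod k) : k * x + p.val < n := by
    have h1 : k * (x + 1) ≤ k * M := Nat.mul_le_mul_left _ x.2
    have h2 : k * M ≤ n := Nat.mul_div_le n k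
    have := p.val_lt
    rw [mul_add] at h1
    omega
  let c (α : Fin (k / l) → Fin M) (p : ZMod k) : Fin n := ⟨k * label α p + p.val, hlt _ _⟩
  have hcpos (α p) : pos (c α p) = p := by simp [hpos, c]
  have hclab (α p) : lab (c α p) = label α p := by
    simp only [hlab, c]
    rw [Nat.mul_add_div (by omega), Nat.div_eq_of_lt p.val_lt, add_zero]
  have hlabel0 (α) {p} (h : ¬IsBundlePos k l p) : (label α p : ℕ) = 0 := by
    simp only [label, dif_neg h]
  have hone : (1 : ZMod k) ≠ 0 := by
    have : Fact (1 < k) := ⟨by omega⟩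
    exact one_ne_zero
  have hseq (α) : (bundledCycle l pos lab).IsCyclicSeq k (c α) := by
    refine ⟨fun p q h => by rw [← hcpos α p, h, hcpos], fun p => ?_⟩
    rw [bundledCycle, SimpleGraph.fromRel_adj]
    refine ⟨fun h => ?_, Or.inl ?_⟩
    · have := congrArg pos h
      rw [hcpos, hcpos] at this
      exact hone (by simpa using this)
    · simp only [hcpos, hclab, true_and]
      refine ⟨hlabel0 α, hlabel0 α, fun h1 h2 => ?_⟩
      have hv := h2.val_add_one
      have : (p + 1).val / l = p.val / l := by
        rw [hv, Nat.succ_div_of_not_dvd]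
        rw [← hv, Nat.dvd_iff_mod_eq_zero]
        exact h2.1
      simp only [label, dif_pos h1, dif_pos h2, this]
  have hH (α) : ∃ H ∈ (bundledCycle l pos lab).cycleSubgraphs, H.verts = Set.range (c α) := by
    obtain ⟨v, p, hp, -, hs⟩ := (hseq α).exists_isCycle (by omega)
    refine ⟨_, ⟨v, p, hp, rfl⟩, ?_⟩
    ext w
    rw [SimpleGraph.Walk.mem_verts_toSubgraph, hs]
    exact ⟨fun ⟨i, h⟩ => ⟨i, h.symm⟩, fun ⟨i, h⟩ => ⟨i, h.symm⟩⟩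
  choose H hHm hHv using hH
  have hHinj : Function.Injective H := by
    intro α β h
    have hr : Set.range (c α) = Set.range (c β) := by rw [← hHv, ← hHv, h]
    have hcc (p) : c α p = c β p := by
      obtain ⟨q, hq⟩ : c α p ∈ Set.range (c β) := hr ▸ ⟨p, rfl⟩
      have : q = p := by rw [← hcpos β q, hq, hcpos]
      rw [← hq, this]
    ext x
    have hx : x * l + l ≤ k / l * l := by
      rw [← Nat.succ_mul]; exact Nat.mul_le_mul_right _ x.2
    have hk' := Nat.div_mul_le_self k l
    have hval : ((x * l + 1 : ℕ) : ZMod k).val = x * l + 1 := by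
      rw [ZMod.val_natCast, Nat.mod_eq_of_lt (by omega)]
    have hdiv : ((x : ℕ) * l + 1) / l = x := by
      rw [mul_comm (x : ℕ), Nat.mul_add_div (by omega), Nat.div_eq_of_lt (show 1 < l by omega), add_zero]
    have hmod : ((x : ℕ) * l + 1) % l = 1 := by
      rw [mul_comm (x : ℕ), Nat.mul_add_mod, Nat.mod_eq_of_lt (show 1 < l by omega)]
    -- The first inner position of arc `x`, where the label reveals `α x`; it exists since `l ≥ 2`.
    have hb : IsBundlePos k l ((x * l + 1 : ℕ) : ZMod k) := by
      rw [IsBundlePos, hval, hmod]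
      omega
    have := congrArg lab (hcc ((x * l + 1 : ℕ) : ZMod k))
    rw [hclab, hclab] at this
    simpa only [label, dif_pos hb, hval, hdiv] using this
  calc M ^ (k / l) = (Set.range H).ncard := by
        rw [Set.ncard_range_of_injective hHinj]; simp
    _ ≤ _ := Set.ncard_le_ncard (by rintro _ ⟨α, rfl⟩; exact hHm α) (Set.toFinite _)

/-! ### The two bounds combined -/

theorem theorem3 (L : Set ℕ) (hL : ∀ m ∈ L, 3 ≤ m) (k l : ℕ)
    (hk : IsGreatest L k) (hl : IsLeast {m | m ∈ L ∧ Even m} (2 * l)) :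
    Asymptotics.IsTheta Filter.atTop
      (fun n : ℕ => (maxLCycles L n : ℝ)) (fun n : ℕ => (n : ℝ) ^ (k / l)) := by
  have hl2 : 2 ≤ l := by have := hL _ hl.1.1; omega
  have hlk : 2 * l ≤ k := hk.2 hl.1.1
  constructor
  · refine Asymptotics.IsBigO.of_bound
      (((k + 1) * ((k * (2 * k)) ^ k * (2 * k) ^ (k / l)) : ℕ) : ℝ) (.of_forall fun n => ?_)
    rw [Real.norm_of_nonneg (Nat.cast_nonneg _), Real.norm_of_nonneg (by positivity)]
    obtain ⟨G, hG, hc⟩ := (isGreatest_maxLCycles L n).1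
    rw [hc]
    have := G.ncard_cycleSubgraphs_le (k := k) (l := l) (by omega) (by omega)
      (fun v p hp => hk.2 (hG v p hp)) (fun v p hp he => hl.2 ⟨hG v p hp, he⟩)
    rw [Fintype.card_fin, mul_pow (2 * k) n, ← mul_assoc ((k * (2 * k)) ^ k),
      ← mul_assoc (k + 1)] at this
    exact_mod_cast this
  · refine Asymptotics.IsBigO.of_bound (((2 * k) ^ (k / l) : ℕ) : ℝ) ?_
    filter_upwards [Filter.eventually_ge_atTop k] with n hn
    rw [Real.norm_of_nonneg (by positivity), Real.norm_of_nonneg (Nat.cast_nonneg _)]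
    obtain ⟨G, hG, hc⟩ := exists_isLCycleGraph_pow_le (n := n) hl2 hlk
    have hmax : G.cycleSubgraphs.ncard ≤ maxLCycles L n :=
      (isGreatest_maxLCycles L n).2 ⟨G, fun v p hp => by
        rcases hG v p hp with h | h
        · rw [h]; exact hk.1
        · rw [h]; exact hl.1.1, rfl⟩
    have h1 : n ≤ 2 * k * (n / k) := by
      have e1 := Nat.div_add_mod n k
      have e2 := Nat.mod_lt n (show k > 0 by omega)
      have e3 : k * 1 ≤ k * (n / k) := Nat.mul_le_mul_left _ (Nat.div_pos hn (by omega))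
      rw [mul_assoc]
      omega
    have h2 : n ^ (k / l) ≤ (2 * k) ^ (k / l) * maxLCycles L n := by
      refine (Nat.pow_le_pow_left h1 _).trans ?_
      rw [mul_pow]
      exact Nat.mul_le_mul_left _ (hc.trans hmax)
    exact_mod_cast h2
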